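/- Fix a functional signature $\sigma$ (operation symbols of finite arity), disjoint from the binary symbols $\{-,\restriction\}$. A difference--restriction algebra is a nonempty $\{-,\restriction\}$-algebra isomorphic to an algebra of partial functions from some set $X$ to some set $Y$, with $f-g$ the set difference of graphs and $f\restriction g$ the restriction of $g$ to the domain of $f$. It is ordered by $a\le b\iff a\cdot b=a$, where $a\cdot b:=a-(a-b)$, it has a bottom element $0$, and $a,b$ are called compatible if $a\restriction b=b\restriction a$. An algebra of $\mathrm{DRA}(\sigma)$ is a $(\{-,\restriction\}\cup\sigma)$-algebra whose $\{-,\restriction\}$-reduct is a difference--restriction algebra and in which each $n$-ary $\Omega\in\sigma$ is compatibility preserving (if $a_i,a_i'$ are compatible for all $i$, then $\Omega(a_1,\dots,a_n)$ and $\Omega(a_1',\dots,a_n')$ are compatible), normal ($\Omega$ is $0$ as soon as one argument is $0$) and additive (in each argument, $\Omega(\dots,b+c,\dots)=\Omega(\dots,b,\dots)+\Omega(\dots,c,\dots)$ whenever the join $b+c$ exists). Let $\mathcal A$ be an algebra of $\mathrm{DRA}(\sigma)$. Let $\mathrm{pf}(\mathcal A)$ be the set of its maximal (proper) filters, with the topology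 generated by the sets $\widehat a=\{\mu\mid a\in\mu\}$, $a\in\mathcal A$; let $\mu\approx\nu$ if $b\restriction a\in\mu$ and $a\restriction b\in\nu$ for all $a\in\mu$, $b\in\nu$; and let $F'(\mathcal A)$ be the quotient map $\pi\colon\mathrm{pf}(\mathcal A)\to\mathrm{pf}(\mathcal A)/{\approx}$ (with the quotient topology) together with, for each $n$-ary $\Omega\in\sigma$, the relation $R_\Omega\,\mu_1\dots\mu_{n+1}\iff\Omega(a_1,\dots,a_n)\in\mu_{n+1}$ for all $a_i\in\mu_i$. A Hausdorff étale space with $\sigma$-relations is a surjective local homeomorphism $\pi\colon X\to X_0$ between Hausdorff spaces together with, for each $n$-ary $\Omega\in\sigma$, an $(n+1)$-ary relation $R$ on $X$ that satisfies the following, where $\Omega_R(S_1,\dots,S_n)=\{x_{n+1}\mid\exists x_i\in S_i:\ R\,x_1\dots x_{n+1}\}$. (i) $R$ is spectral: $\Omega_R$ sends open sets to open sets, and compact open sets to compact open sets. (ii) $R$ is tight: if $x_{n+1}\in\Omega_R(S_1,\dots,S_n)$ for all compact open $S_i\ni x_i$, then $R\,x_1\dots x_{n+1}$. (iii) $R$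 has the compatibility property: writing $x\mathrel Cy$ for $\pi(x)=\pi(y)\Rightarrow x=y$, if $x_i\mathrel Cx_i'$ for all $i\le n$, $R\,x_1\dots x_{n+1}$ and $R\,x_1'\dots x_{n+1}'$, then $x_{n+1}\mathrel Cx_{n+1}'$. For such a space, let $G'(\pi)$ be the algebra of all compact open $U\subseteq X$ on which $\pi$ is injective, with $U-V$ the set difference, $U\restriction V=\pi^{-1}(\pi(U))\cap V$, and each $\Omega\in\sigma$ interpreted as $\Omega_R$. Claim: for every algebra $\mathcal A$ in $\mathrm{DRA}(\sigma)$, $F'(\mathcal A)$ is a Hausdorff étale space with $\sigma$-relations, and $\eta_{\mathcal A}\colon\mathcal A\to G'(F'(\mathcal A))$, $a\mapsto\widehat a$, is well defined and is the finitary compatible completion of $\mathcal A$ in $\mathrm{DRA}(\sigma)$. That is, $G'(F'(\mathcal A))$ is in $\mathrm{DRA}(\sigma)$; each of its finite sets of pairwise compatible elements has a join; $\eta_{\mathcal A}$ is an injective homomorphism of $(\{-,\restriction\}\cup\sigma)$-algebras (in particular, it preserves the additional operators); and every element of $G'(F'(\mathcal A))$ is the join of a finite subset of $\eta_{\mathcal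 A}[\mathcal A]$. Moreover, for every $\iota\colon\mathcal A\to\mathcal C$ with these same properties there is a unique isomorphism $\theta\colon G'(F'(\mathcal A))\to\mathcal C$ of $(\{-,\restriction\}\cup\sigma)$-algebras with $\theta\circ\eta_{\mathcal A}=\iota$. -/

import Mathlib

universe u v w

namespace DiffRest

/-! ### Partial functions -/

section PartialFunctions

variable {X Y : Type u}

/-- A subset of `X × Y` is a partial function from `X` to `Y` if it is single-valued. -/
def IsPartialFunction (f : Set (X × Y)) : Prop :=
  ∀ x y z, (x, y) ∈ f → (x, z) ∈ f → y = z

/-- The domain of a partial function. -/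
def pdom (f : Set (X × Y)) : Set X := {x | ∃ y, (x, y) ∈ f}

/-- Domain restriction `f ▷ g`: the restriction of the second argument to the domain of the
first. -/
def domRestrict (f g : Set (X × Y)) : Set (X × Y) := {p | p.1 ∈ pdom f ∧ p ∈ g}

end PartialFunctions

/-! ### Algebras -/

/-- A functional signature: a collection of operation symbols, each with a finite arity. -/
structure FunSignature where
  Symbol : Type w
  arity : Symbol → ℕ

/-- An algebra of the signature `{-, ▷} ∪ σ`; algebras are nonempty. -/
structure Alg (σ : FunSignature.{w}) where
  carrier : Type u
  nonempty : Nonempty carrier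
  diff : carrier → carrier → carrier
  rest : carrier → carrier → carrier
  op : (s : σ.Symbol) → (Fin (σ.arity s) → carrier) → carrier

instance {σ : FunSignature.{w}} : CoeSort (Alg.{u, w} σ) (Type u) := ⟨Alg.carrier⟩

namespace Alg

variable {σ : FunSignature.{w}}

/-- The derived meet `a · b = a - (a - b)`. -/
def meet (A : Alg.{u, w} σ) (a b : A) : A := A.diff a (A.diff a b)

/-- The order of the algebra: `a ≤ b` if and only if `a · b = a`. -/
instance (A : Alg.{u, w} σ) : LE A.carrier := ⟨fun a b => A.meet a b = a⟩

/-- `θ` is an isomorphism of the `{-, ▷}`-reduct of `A` onto an algebra of partial functions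
from `X` to `Y` (whose universe is then the range of `θ`). -/
structure IsRepresentation (A : Alg.{u, w} σ) {X Y : Type u} (θ : A → Set (X × Y)) : Prop where
  isPartialFunction : ∀ a, IsPartialFunction (θ a)
  injective : Function.Injective θ
  map_diff : ∀ a b, θ (A.diff a b) = θ a \ θ b
  map_rest : ∀ a b, θ (A.rest a b) = domRestrict (θ a) (θ b)

/-- The `{-, ▷}`-reduct of `A` is a difference--restriction algebra. -/
def IsDifferenceRestriction (A : Alg.{u, w} σ) : Prop :=
  ∃ (X Y : Type u) (θ : A → Set (X × Y)), A.IsRepresentation θ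

/-- Two elements are compatible if each restricts the other in the same way. -/
def Compatible (A : Alg.{u, w} σ) (a b : A) : Prop := A.rest a b = A.rest b a

/-- Compatibility preserving `n`-ary operations. -/
def CompatibilityPreserving (A : Alg.{u, w} σ) {n : ℕ} (Ω : (Fin n → A) → A) : Prop :=
  ∀ a a' : Fin n → A, (∀ i, A.Compatible (a i) (a' i)) → A.Compatible (Ω a) (Ω a')

/-- Normality: the value is `0` (the bottom element) as soon as one argument is. -/
def Normal (A : Alg.{u, w} σ) {n : ℕ} (Ω : (Fin n → A) → A) : Prop :=
  ∀ (i : Fin n) (a : Fin n → A) (z : A), IsBot z → Ω (Function.update a i z) = z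

/-- Additivity: in each argument, every existing binary join is sent to a join. -/
def Additive (A : Alg.{u, w} σ) {n : ℕ} (Ω : (Fin n → A) → A) : Prop :=
  ∀ (i : Fin n) (a : Fin n → A) (b c s : A), IsLUB {b, c} s →
    IsLUB {Ω (Function.update a i b), Ω (Function.update a i c)} (Ω (Function.update a i s))

/-- Membership in `DRA(σ)`: the `{-, ▷}`-reduct is a difference--restriction algebra and the
symbols of `σ` are interpreted as compatibility preserving operators. -/
structure IsDRA (A : Alg.{u, w} σ) : Prop where
  isDifferenceRestriction : A.IsDifferenceRestriction
  compatibilityPreserving : ∀ s, A.CompatibilityPreserving (A.op s)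
  normal : ∀ s, A.Normal (A.op s)
  additive : ∀ s, A.Additive (A.op s)

/-- Homomorphisms of `({-, ▷} ∪ σ)`-algebras. -/
structure IsHom (A : Alg.{u, w} σ) (B : Alg.{v, w} σ) (h : A → B) : Prop where
  map_diff : ∀ a b, h (A.diff a b) = B.diff (h a) (h b)
  map_rest : ∀ a b, h (A.rest a b) = B.rest (h a) (h b)
  map_op : ∀ s (a : Fin (σ.arity s) → A), h (A.op s a) = B.op s (fun i => h (a i))

/-- Joins exist for all finite sets of pairwise-compatible elements. -/
def FinitarilyCompatiblyComplete (A : Alg.{u, w} σ) : Prop :=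
  ∀ S : Set A, S.Finite → (∀ a ∈ S, ∀ b ∈ S, A.Compatible a b) → ∃ c, IsLUB S c

/-- Every element is the join of some finite subset of `S`. -/
def FiniteJoinDense (A : Alg.{u, w} σ) (S : Set A) : Prop :=
  ∀ p : A, ∃ T : Set A, T ⊆ S ∧ T.Finite ∧ IsLUB T p

/-- `ι` is a finitary compatible completion of `A` in `DRA(σ)`. -/
structure IsFinitaryCompatibleCompletion (A : Alg.{u, w} σ) (C : Alg.{v, w} σ) (ι : A → C) :
    Prop where
  isDRA : C.IsDRA
  complete : C.FinitarilyCompatiblyComplete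
  isHom : IsHom A C ι
  injective : Function.Injective ι
  dense : C.FiniteJoinDense (Set.range ι)

end Alg

/-! ### Hausdorff étale spaces with relations -/

section Relations

variable {X : Type u} {X₀ : Type u}

/-- The operation on subsets given by an `(n+1)`-ary relation. -/
def opOfRel {n : ℕ} (R : (Fin n → X) → X → Prop) (S : Fin n → Set X) : Set X :=
  {y | ∃ x : Fin n → X, (∀ i, x i ∈ S i) ∧ R x y}

/-- The compatibility relation of a map. -/
def CompatiblePoints (π : X → X₀) (x y : X) : Prop := π x = π y → x = y

/-- The compatibility property of a relation. -/
def CompatibilityProperty (π : X → X₀) {n : ℕ} (R : (Fin n → X) → X → Prop) : Prop :=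
  ∀ (x x' : Fin n → X) (y y' : X), (∀ i, CompatiblePoints π (x i) (x' i)) →
    R x y → R x' y' → CompatiblePoints π y y'

/-- Continuous relations. -/
def ContinuousRel [TopologicalSpace X] {n : ℕ} (R : (Fin n → X) → X → Prop) : Prop :=
  ∀ S : Fin n → Set X, (∀ i, IsOpen (S i)) → IsOpen (opOfRel R S)

/-- Spectral relations. -/
def SpectralRel [TopologicalSpace X] {n : ℕ} (R : (Fin n → X) → X → Prop) : Prop :=
  ContinuousRel R ∧ ∀ S : Fin n → Set X, (∀ i, IsCompact (S i) ∧ IsOpen (S i)) →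
    IsCompact (opOfRel R S) ∧ IsOpen (opOfRel R S)

/-- Tight relations. -/
def TightRel [TopologicalSpace X] {n : ℕ} (R : (Fin n → X) → X → Prop) : Prop :=
  ∀ (x : Fin n → X) (y : X),
    (∀ S : Fin n → Set X, (∀ i, IsCompact (S i) ∧ IsOpen (S i)) → (∀ i, x i ∈ S i) →
      y ∈ opOfRel R S) → R x y

end Relations

/-- A map between topological spaces together with, for each symbol of `σ` of arity `n`, an
`(n+1)`-ary relation on its domain. -/
structure RelMap (σ : FunSignature.{w}) where
  X : Type u
  X₀ : Type u
  topX : TopologicalSpace X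
  topX₀ : TopologicalSpace X₀
  π : X → X₀
  rel : (s : σ.Symbol) → (Fin (σ.arity s) → X) → X → Prop

attribute [instance] RelMap.topX RelMap.topX₀

variable {σ : FunSignature.{w}}

/-- The objects of `HausEt(σ)`: Hausdorff étale spaces (surjective local homeomorphisms between
Hausdorff spaces) with tight spectral relations that have the compatibility property. -/
structure RelMap.IsHausEt (E : RelMap.{u, w} σ) : Prop where
  t2X : T2Space E.X
  t2X₀ : T2Space E.X₀
  isLocalHomeomorph : IsLocalHomeomorph E.π
  surjective : Function.Surjective E.π
  compatibilityProperty : ∀ s, CompatibilityProperty E.π (E.rel s)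
  spectral : ∀ s, SpectralRel (E.rel s)
  tight : ∀ s, TightRel (E.rel s)

/-! ### The object part of `F'` -/

/-- Filters of the poset `A`: nonempty, upward closed, downward directed subsets. -/
structure IsFilter (A : Alg.{u, w} σ) (F : Set A) : Prop where
  nonempty : F.Nonempty
  mem_of_le : ∀ a b : A, a ≤ b → a ∈ F → b ∈ F
  directed : ∀ a ∈ F, ∀ b ∈ F, ∃ c ∈ F, c ≤ a ∧ c ≤ b

/-- The set of maximal filters: the proper filters that are maximal with respect to inclusion
among all proper filters. -/
def MaxFilter (A : Alg.{u, w} σ) : Type u :=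
  {μ : Set A // Maximal (fun F : Set A => IsFilter A F ∧ F ≠ Set.univ) μ}

/-- The set of all maximal filters that contain `a`. -/
def hat (A : Alg.{u, w} σ) (a : A) : Set (MaxFilter A) := {μ | a ∈ μ.1}

/-- The topology on maximal filters generated by the sets `hat A a`. -/
instance (A : Alg.{u, w} σ) : TopologicalSpace (MaxFilter A) :=
  TopologicalSpace.generateFrom (Set.range (hat A))

/-- The domain inclusion preorder on filters: `F` is below `G` if `G ▷ F ⊆ F`. -/
def DomLE (A : Alg.{u, w} σ) (F G : Set A) : Prop := ∀ g ∈ G, ∀ f ∈ F, A.rest g f ∈ F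

theorem Alg.IsRepresentation.le_iff {A : Alg.{u, w} σ} {X Y : Type u} {θ : A → Set (X × Y)}
    (hθ : A.IsRepresentation θ) (a b : A) : a ≤ b ↔ θ a ⊆ θ b := by
  change A.diff a (A.diff a b) = a ↔ _
  rw [← hθ.injective.eq_iff, hθ.map_diff, hθ.map_diff, sdiff_sdiff_right_self]
  exact inf_eq_left

theorem domLE_refl {A : Alg.{u, w} σ} (hA : A.IsDifferenceRestriction) {F : Set A}
    (hF : IsFilter A F) : DomLE A F F := by
  obtain ⟨X, Y, θ, hθ⟩ := hA
  intro g hg f hf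
  obtain ⟨c, hc, hcg, hcf⟩ := hF.directed g hg f hf
  refine hF.mem_of_le c _ ?_ hc
  rw [hθ.le_iff] at hcg hcf ⊢
  rw [hθ.map_rest]
  exact fun p hp => ⟨⟨p.2, hcg hp⟩, hcf hp⟩

theorem domLE_trans {A : Alg.{u, w} σ} (hA : A.IsDifferenceRestriction) {F G H : Set A}
    (hF : IsFilter A F) (hG : IsFilter A G) (h₁ : DomLE A F G) (h₂ : DomLE A G H) :
    DomLE A F H := by
  obtain ⟨X, Y, θ, hθ⟩ := hA
  intro c hc a ha
  obtain ⟨b, hb⟩ := hG.nonempty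
  refine hF.mem_of_le _ _ ?_ (h₁ _ (h₂ c hc b hb) a ha)
  rw [hθ.le_iff]
  simp only [hθ.map_rest]
  rintro p ⟨⟨y, hy, -⟩, hp⟩
  exact ⟨hy, hp⟩

/-- The equivalence relation on maximal filters induced by the domain inclusion preorder. -/
def approx (A : Alg.{u, w} σ) (hA : A.IsDifferenceRestriction) : Setoid (MaxFilter A) where
  r μ ν := DomLE A μ.1 ν.1 ∧ DomLE A ν.1 μ.1
  iseqv :=
    { refl := fun μ => ⟨domLE_refl hA μ.2.prop.1, domLE_refl hA μ.2.prop.1⟩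
      symm := fun h => ⟨h.2, h.1⟩
      trans := fun {μ ν ξ} h k =>
        ⟨domLE_trans hA μ.2.prop.1 ν.2.prop.1 h.1 k.1,
          domLE_trans hA ξ.2.prop.1 ν.2.prop.1 k.2 h.2⟩ }

/-- The relation on maximal filters given by an `n`-ary operation. -/
def relOfOp (A : Alg.{u, w} σ) {n : ℕ} (Ω : (Fin n → A) → A) (μ : Fin n → MaxFilter A)
    (ν : MaxFilter A) : Prop :=
  ∀ a : Fin n → A, (∀ i, a i ∈ (μ i).1) → Ω a ∈ ν.1

/-- `F'(A)`: the canonical quotient of the space of maximal filters (the quotient set carries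
the quotient topology), with the relations given by the operations of `A`. -/
def FObj (A : Alg.{u, w} σ) (hA : A.IsDRA) : RelMap.{u, w} σ where
  X := MaxFilter A
  X₀ := Quotient (approx A hA.isDifferenceRestriction)
  topX := inferInstance
  topX₀ := inferInstance
  π := Quotient.mk _
  rel s := relOfOp A (A.op s)

/-! ### The object part of `G'` -/

/-- The compact open subsets on which `π` is injective. -/
def RelMap.IsKO (E : RelMap.{u, w} σ) (U : Set E.X) : Prop :=
  IsCompact U ∧ IsOpen U ∧ Set.InjOn E.π U

theorem RelMap.IsHausEt.isKO_diff {E : RelMap.{u, w} σ} (hE : E.IsHausEt) {U V : Set E.X}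
    (hU : E.IsKO U) (hV : E.IsKO V) : E.IsKO (U \ V) := by
  have := hE.t2X
  exact ⟨hU.1.diff hV.2.1, hU.2.1.sdiff hV.1.isClosed, hU.2.2.mono Set.sdiff_subset⟩

theorem RelMap.IsHausEt.isKO_rest {E : RelMap.{u, w} σ} (hE : E.IsHausEt) {U V : Set E.X}
    (hU : E.IsKO U) (hV : E.IsKO V) : E.IsKO (E.π ⁻¹' (E.π '' U) ∩ V) := by
  have := hE.t2X₀
  have hc : Continuous E.π := hE.isLocalHomeomorph.continuous
  refine ⟨hV.1.inter_left ((hU.1.image hc).isClosed.preimage hc), ?_,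
    hV.2.2.mono Set.inter_subset_right⟩
  exact ((hE.isLocalHomeomorph.isOpenMap _ hU.2.1).preimage hc).inter hV.2.1

theorem RelMap.IsHausEt.isKO_op {E : RelMap.{u, w} σ} (hE : E.IsHausEt) (s : σ.Symbol)
    {U : Fin (σ.arity s) → Set E.X} (hU : ∀ i, E.IsKO (U i)) :
    E.IsKO (opOfRel (E.rel s) U) := by
  have h := (hE.spectral s).2 U fun i => ⟨(hU i).1, (hU i).2.1⟩
  refine ⟨h.1, h.2, ?_⟩
  rintro y ⟨x, hx, hxy⟩ y' ⟨x', hx', hxy'⟩ he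
  exact hE.compatibilityProperty s x x' y y'
    (fun i => (hU i).2.2 (hx i) (hx' i)) hxy hxy' he

/-- `G'(E)`: the algebra of compact open subsets `U` on which `π` is injective, with
`U - V` the set difference, `U ▷ V = π⁻¹(π(U)) ∩ V`, and the operations given by the
relations. -/
def GObj (E : RelMap.{u, w} σ) (hE : E.IsHausEt) : Alg.{u, w} σ where
  carrier := {U : Set E.X // E.IsKO U}
  nonempty := ⟨⟨∅, isCompact_empty, isOpen_empty, Set.injOn_empty _⟩⟩
  diff U V := ⟨U.1 \ V.1, hE.isKO_diff U.2 V.2⟩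
  rest U V := ⟨E.π ⁻¹' (E.π '' U.1) ∩ V.1, hE.isKO_rest U.2 V.2⟩
  op s U := ⟨opOfRel (E.rel s) (fun i => (U i).1), hE.isKO_op s fun i => (U i).2⟩

end DiffRest

namespace DiffRest

/-! ### Calculus of point representations. -/

variable {σ : FunSignature.{w}}

/-! Every computation takes place on sets of points. In a point representation, compatibility says
that points of the two sets with the same image under `d` coincide, and a finite join, when it
exists, is exactly a union (`isLUB_iff`). The compact open sets of an étale space represent
themselves, so one calculus serves `A`, its completions and `G'`.

A maximal filter is an ultrafilter below each of its members (`maximal_iff`), hence prime for finite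
covers (`maxFilter_prime`). So `hat` respects differences, and the compact open sets are finite
unions of sets `hat A a`. That `hat` respects `▷` amounts to transporting a maximal filter to an
equivalent one through a given element (`exists_approx_of_rest_mem`).

The operators need an existence statement: if `Ω a ∈ ν`, then there are maximal filters through the
`a i` that are related to `ν` (`exists_relOfOp`). They are found one coordinate at a time by a prime
ideal argument, in which additivity and normality make the forbidden elements an ideal. Spectrality
and preservation of the operators follow.

For uniqueness, an element `c` of any completion is a finite join of images of elements of `A`, and
`trace` sends it to the union of the corresponding sets `hat A a`. Since `trace` is defined from the
order alone, no choice of join enters; it is an isomorphism onto `G'`, and its inverse is the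
required map. No other is possible, because isomorphisms preserve the joins that generate `G'`. -/

/-- `θ` represents the `{-, ▷}`-reduct of `A` by sets of points, on each of which `d` is
injective. Domains of elements are the images under `d`. -/
structure PointRep (A : Alg.{u, w} σ) {P D : Type*} (d : P → D) (θ : A → Set P) : Prop where
  injOn : ∀ a, Set.InjOn d (θ a)
  injective : Function.Injective θ
  map_diff : ∀ a b, θ (A.diff a b) = θ a \ θ b
  map_rest : ∀ a b, θ (A.rest a b) = d ⁻¹' (d '' θ a) ∩ θ b

theorem Alg.IsRepresentation.pointRep {A : Alg.{u, w} σ} {X Y : Type u} {θ : A → Set (X × Y)}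
    (h : A.IsRepresentation θ) : PointRep A Prod.fst θ where
  injOn := by
    rintro a ⟨x, y⟩ hp ⟨x', y'⟩ hq rfl
    rw [h.isPartialFunction a _ _ _ hp hq]
  injective := h.injective
  map_diff := h.map_diff
  map_rest a b := by
    rw [h.map_rest]
    ext ⟨x, y⟩
    simp [domRestrict, pdom]

namespace PointRep

variable {A : Alg.{u, w} σ} {P D : Type*} {d : P → D} {θ : A → Set P}

/-- A point `p` becomes the pair `(d p, p)`; injectivity of `d` on each set is single-valuedness. -/
theorem isDifferenceRestriction {P D : Type u} {d : P → D} {θ : A → Set P}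
    (h : PointRep A d θ) : A.IsDifferenceRestriction := by
  refine ⟨D, P, fun a => {p | p.2 ∈ θ a ∧ d p.2 = p.1}, ?_, ?_, ?_, ?_⟩
  · rintro a x y z ⟨hy, e⟩ ⟨hz, e'⟩
    exact h.injOn a hy hz (e.trans e'.symm)
  · intro a b e
    apply h.injective
    ext p
    have := Set.ext_iff.1 e (d p, p)
    simpa using this
  · intro a b
    ext ⟨x, y⟩
    simp only [h.map_diff, Set.mem_ofPred_eq, Set.mem_sdiff]
    tauto
  · intro a b
    ext ⟨x, y⟩
    simp only [h.map_rest, domRestrict, pdom, Set.mem_ofPred_eq, Set.mem_inter_iff,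
      Set.mem_preimage, Set.mem_image]
    constructor
    · rintro ⟨⟨⟨q, hq, e⟩, hy⟩, rfl⟩
      exact ⟨⟨q, hq, e⟩, hy, rfl⟩
    · rintro ⟨⟨q, hq, e⟩, hy, rfl⟩
      exact ⟨⟨⟨q, hq, e⟩, hy⟩, rfl⟩

variable (h : PointRep A d θ)
include h

/-- Lets an algebra and an extension of it be represented over the same points, so that covers in
one can be read in the other. -/
theorem comp {B : Alg.{v, w} σ} {ι : B → A} (hι : Alg.IsHom B A ι)
    (inj : Function.Injective ι) : PointRep B d (fun b => θ (ι b)) where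
  injOn b := h.injOn _
  injective := h.injective.comp inj
  map_diff a b := by rw [hι.map_diff, h.map_diff]
  map_rest a b := by rw [hι.map_rest, h.map_rest]

theorem map_meet (a b : A) : θ (A.meet a b) = θ a ∩ θ b := by
  rw [Alg.meet, h.map_diff, h.map_diff, sdiff_sdiff_right_self]
  rfl

theorem le_iff (a b : A) : a ≤ b ↔ θ a ⊆ θ b := by
  change A.meet a b = a ↔ _
  rw [← h.injective.eq_iff, h.map_meet]
  exact inf_eq_left

theorem antisymm {a b : A} (h₁ : a ≤ b) (h₂ : b ≤ a) : a = b :=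
  h.injective (((h.le_iff _ _).1 h₁).antisymm ((h.le_iff _ _).1 h₂))

theorem isBot_iff (z : A) : IsBot z ↔ θ z = ∅ := by
  constructor
  · intro hz
    have := (h.le_iff _ _).1 (hz (A.diff z z))
    rwa [h.map_diff, sdiff_self, Set.bot_eq_empty, Set.subset_empty_iff] at this
  · intro hz a
    rw [h.le_iff, hz]
    exact Set.empty_subset _

theorem compatible_iff (a b : A) :
    A.Compatible a b ↔ ∀ p ∈ θ a, ∀ q ∈ θ b, d p = d q → p = q := by
  rw [Alg.Compatible, ← h.injective.eq_iff, h.map_rest, h.map_rest]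
  constructor
  · intro e p hp q hq hpq
    have hq' : q ∈ d ⁻¹' (d '' θ a) ∩ θ b := ⟨⟨p, hp, hpq⟩, hq⟩
    rw [e] at hq'
    exact h.injOn a hp hq'.2 hpq
  · intro H
    ext p
    constructor
    · rintro ⟨⟨q, hq, e⟩, hp⟩
      obtain rfl := H q hq p hp e
      exact ⟨⟨q, hp, rfl⟩, hq⟩
    · rintro ⟨⟨q, hq, e⟩, hp⟩
      obtain rfl := H p hp q hq e.symm
      exact ⟨⟨p, hp, rfl⟩, hq⟩

/-- The join of `T` may fail to exist, but its members can be subtracted one after another. -/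
theorem exists_diff_biUnion (c : A) {T : Set A} (hT : T.Finite) :
    ∃ e, θ e = θ c \ ⋃ t ∈ T, θ t := by
  induction T, hT using Set.Finite.induction_on with
  | empty => exact ⟨c, by simp⟩
  | @insert a S _ _ ih =>
    obtain ⟨e, he⟩ := ih
    refine ⟨A.diff e a, ?_⟩
    rw [h.map_diff, he, Set.biUnion_insert, sdiff_sdiff, Set.union_comm]
    rfl

/-- If a join `c` had points outside the union, subtracting them would leave a smaller upper bound,
and this remainder is an element of the algebra. -/
theorem isLUB_iff {T : Set A} (hT : T.Finite) (c : A) : IsLUB T c ↔ θ c = ⋃ t ∈ T, θ t := by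
  constructor
  · intro hc
    have hsub : (⋃ t ∈ T, θ t) ⊆ θ c :=
      Set.iUnion₂_subset fun t ht => (h.le_iff _ _).1 (hc.1 ht)
    refine Set.Subset.antisymm ?_ hsub
    obtain ⟨e, he⟩ := h.exists_diff_biUnion c hT
    have hd : θ (A.diff c e) = ⋃ t ∈ T, θ t := by
      rw [h.map_diff, he, sdiff_sdiff_right_self]
      exact inf_eq_right.2 hsub
    rw [← hd, ← h.le_iff]
    refine hc.2 fun t ht => ?_
    rw [h.le_iff, hd]
    exact Set.subset_biUnion_of_mem (u := fun t => θ t) ht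
  · intro hc
    refine ⟨fun t ht => ?_, fun b hb => ?_⟩
    · rw [h.le_iff, hc]
      exact Set.subset_biUnion_of_mem (u := fun t => θ t) ht
    · rw [h.le_iff, hc]
      exact Set.iUnion₂_subset fun t ht => (h.le_iff _ _).1 (hb ht)

theorem isLUB_pair_iff (a b c : A) : IsLUB {a, b} c ↔ θ c = θ a ∪ θ b := by
  rw [h.isLUB_iff (Set.toFinite _), Set.biUnion_pair]

theorem exists_union_of_le {a b c : A} (ha : a ≤ c) (hb : b ≤ c) : ∃ s, θ s = θ a ∪ θ b := by
  refine ⟨A.diff c (A.diff (A.diff c a) b), ?_⟩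
  rw [h.le_iff] at ha hb
  simp only [h.map_diff]
  ext p
  have := @ha p
  have := @hb p
  simp only [Set.mem_sdiff, Set.mem_union]
  tauto

/-! ### Maximal filters -/

theorem meet_mem_of_isFilter {F : Set A} (hF : IsFilter A F) {a b : A} (ha : a ∈ F) (hb : b ∈ F) :
    A.meet a b ∈ F := by
  obtain ⟨c, hc, hca, hcb⟩ := hF.directed a ha b hb
  refine hF.mem_of_le c _ ?_ hc
  rw [h.le_iff] at hca hcb ⊢
  rw [h.map_meet]
  exact Set.subset_inter hca hcb

theorem ne_univ_iff {F : Set A} (hF : IsFilter A F) :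
    F ≠ Set.univ ↔ ∀ a ∈ F, (θ a).Nonempty := by
  constructor
  · intro hne a ha
    by_contra he
    rw [Set.not_nonempty_iff_eq_empty] at he
    refine hne (Set.eq_univ_of_forall fun b => hF.mem_of_le a b ?_ ha)
    exact (h.isBot_iff a).2 he b
  · rintro H rfl
    obtain ⟨a⟩ := A.nonempty
    have := H (A.diff a a) trivial
    simp [h.map_diff] at this

/-- If `a ∈ F` and `F` contains neither part of `a`, then adjoining `b` gives a strictly larger
filter `G`. Were `G` improper, some `f · b` with `f ∈ F` would be `0`, and then `f · a ≤ a - b`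
would put `a - b` in `F`. -/
theorem maximal_iff (F : Set A) : Maximal (fun F : Set A => IsFilter A F ∧ F ≠ Set.univ) F ↔
    IsFilter A F ∧ (∀ a ∈ F, (θ a).Nonempty) ∧
      ∀ a ∈ F, ∀ b, A.meet a b ∈ F ∨ A.diff a b ∈ F := by
  constructor
  · rintro ⟨⟨hF, hne⟩, hmax⟩
    refine ⟨hF, (h.ne_univ_iff hF).1 hne, fun a ha b => ?_⟩
    by_contra! hcon
    let G : Set A := {x | ∃ f ∈ F, A.meet f b ≤ x}
    have hG : IsFilter A G := by
      refine ⟨⟨_, a, ha, (h.le_iff _ _).2 subset_rfl⟩, ?_, ?_⟩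
      · rintro x y hxy ⟨f, hf, hfx⟩
        refine ⟨f, hf, ?_⟩
        rw [h.le_iff] at *
        exact hfx.trans hxy
      · rintro x ⟨f, hf, hfx⟩ y ⟨g, hg, hgy⟩
        refine ⟨_, ⟨_, h.meet_mem_of_isFilter hF hf hg, (h.le_iff _ _).2 subset_rfl⟩, ?_, ?_⟩
        all_goals
          rw [h.le_iff] at *
          simp only [h.map_meet] at *
        · exact (Set.inter_subset_inter_left _ Set.inter_subset_left).trans hfx
        · exact (Set.inter_subset_inter_left _ Set.inter_subset_right).trans hgy
    have hGne : G ≠ Set.univ := by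
      rw [h.ne_univ_iff hG]
      rintro x ⟨f, hf, hfx⟩
      by_contra he
      rw [Set.not_nonempty_iff_eq_empty] at he
      rw [h.le_iff, he, h.map_meet, Set.subset_empty_iff] at hfx
      refine hcon.2 (hF.mem_of_le _ _ ?_ (h.meet_mem_of_isFilter hF hf ha))
      rw [h.le_iff, h.map_meet, h.map_diff]
      exact fun p hp => ⟨hp.2, fun hb => (Set.ext_iff.1 hfx p).1 ⟨hp.1, hb⟩⟩
    refine hcon.1 (hmax ⟨hG, hGne⟩ (fun f hf => ⟨f, hf, ?_⟩) ⟨a, ha, (h.le_iff _ _).2 subset_rfl⟩)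
    rw [h.le_iff, h.map_meet]
    exact Set.inter_subset_left
  · rintro ⟨hF, hne, hult⟩
    refine ⟨⟨hF, (h.ne_univ_iff hF).2 hne⟩, ?_⟩
    rintro G ⟨hG, hGne⟩ hFG g hg
    obtain ⟨f, hf⟩ := hF.nonempty
    rcases hult f hf g with hm | hm
    · refine hF.mem_of_le _ _ ?_ hm
      rw [h.le_iff, h.map_meet]
      exact Set.inter_subset_right
    · obtain ⟨p, hp⟩ := (h.ne_univ_iff hG).1 hGne _ (h.meet_mem_of_isFilter hG hg (hFG hm))
      rw [h.map_meet, h.map_diff] at hp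
      exact absurd hp.1 hp.2.2

theorem maxFilter_mem_of_le (μ : MaxFilter A) {a b : A} (hab : θ a ⊆ θ b) (ha : a ∈ μ.1) :
    b ∈ μ.1 :=
  μ.2.prop.1.mem_of_le a b ((h.le_iff _ _).2 hab) ha

theorem maxFilter_meet_mem_iff (μ : MaxFilter A) (a b : A) :
    A.meet a b ∈ μ.1 ↔ a ∈ μ.1 ∧ b ∈ μ.1 := by
  refine ⟨fun hm => ⟨?_, ?_⟩, fun hm => h.meet_mem_of_isFilter μ.2.prop.1 hm.1 hm.2⟩
  · exact h.maxFilter_mem_of_le μ (by rw [h.map_meet]; exact Set.inter_subset_left) hm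
  · exact h.maxFilter_mem_of_le μ (by rw [h.map_meet]; exact Set.inter_subset_right) hm

theorem maxFilter_nonempty (μ : MaxFilter A) {a : A} (ha : a ∈ μ.1) : (θ a).Nonempty :=
  (h.ne_univ_iff μ.2.prop.1).1 μ.2.prop.2 a ha

theorem maxFilter_diff_mem_iff (μ : MaxFilter A) (a b : A) :
    A.diff a b ∈ μ.1 ↔ a ∈ μ.1 ∧ b ∉ μ.1 := by
  constructor
  · intro hm
    refine ⟨h.maxFilter_mem_of_le μ (by rw [h.map_diff]; exact Set.sdiff_subset) hm, fun hb => ?_⟩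
    obtain ⟨p, hp⟩ := h.maxFilter_nonempty μ ((h.maxFilter_meet_mem_iff μ _ _).2 ⟨hm, hb⟩)
    rw [h.map_meet, h.map_diff] at hp
    exact hp.1.2 hp.2
  · rintro ⟨ha, hb⟩
    exact (((h.maximal_iff _).1 μ.2).2.2 a ha b).resolve_left
      fun hm => hb ((h.maxFilter_meet_mem_iff μ _ _).1 hm).2

/-- A finite set covering an element of a maximal filter meets the filter. -/
theorem maxFilter_prime (μ : MaxFilter A) {a : A} (ha : a ∈ μ.1) {T : Set A} (hT : T.Finite)
    (hcov : θ a ⊆ ⋃ t ∈ T, θ t) : ∃ t ∈ T, t ∈ μ.1 := by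
  by_contra! hcon
  -- If no `t` is in `μ`, removing them one at a time never leaves `μ`, yet at the end nothing
  -- remains.
  have key : ∀ e, θ e = θ a \ ⋃ t ∈ T, θ t → e ∈ μ.1 := by
    clear hcov
    induction T, hT using Set.Finite.induction_on with
    | empty =>
      intro e he
      rw [Set.biUnion_empty, Set.sdiff_empty] at he
      rwa [h.injective he]
    | @insert b S _ hS ih =>
      intro e he
      obtain ⟨e', he'⟩ := h.exists_diff_biUnion a hS
      have h1 := ih (fun t ht => hcon t (Set.mem_insert_of_mem _ ht)) e' he'
      have h2 := (h.maxFilter_diff_mem_iff μ _ _).2 ⟨h1, hcon b (Set.mem_insert _ _)⟩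
      have : e = A.diff e' b := by
        apply h.injective
        rw [he, h.map_diff, he', Set.biUnion_insert, sdiff_sdiff, Set.union_comm]
        rfl
      rwa [this]
  obtain ⟨e, he⟩ := h.exists_diff_biUnion a hT
  obtain ⟨p, hp⟩ := h.maxFilter_nonempty μ (key e he)
  rw [he] at hp
  exact hp.2 (hcov hp.1)

/-- The maximal filter of all elements containing a given point. -/
theorem maximal_point {a : A} {p : P} (hp : p ∈ θ a) :
    Maximal (fun F : Set A => IsFilter A F ∧ F ≠ Set.univ) {b | p ∈ θ b} := by
  rw [h.maximal_iff]
  refine ⟨⟨⟨a, hp⟩, fun b c hbc hb => (h.le_iff _ _).1 hbc hb, ?_⟩, fun b hb => ⟨p, hb⟩, ?_⟩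
  · intro b hb c hc
    refine ⟨A.meet b c, ?_, ?_, ?_⟩
    · change p ∈ θ _
      rw [h.map_meet]
      exact ⟨hb, hc⟩
    · rw [h.le_iff, h.map_meet]
      exact Set.inter_subset_left
    · rw [h.le_iff, h.map_meet]
      exact Set.inter_subset_right
  · intro b hb c
    change p ∈ θ _ ∨ p ∈ θ _
    rw [h.map_meet, h.map_diff]
    by_cases hc : p ∈ θ c
    · exact Or.inl ⟨hb, hc⟩
    · exact Or.inr ⟨hb, hc⟩

theorem subset_biUnion_of_hat {a : A} {T : Set A} (hT : hat A a ⊆ ⋃ t ∈ T, hat A t) :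
    θ a ⊆ ⋃ t ∈ T, θ t := by
  intro p hp
  obtain ⟨t, ht, hpt⟩ := Set.mem_iUnion₂.1 (@hT ⟨_, h.maximal_point hp⟩ hp)
  exact Set.mem_iUnion₂.2 ⟨t, ht, hpt⟩

/-- For `f ∈ μ`, injectivity of `d` on `a` gives `(f · a) ▷ a ≤ f`, so `f ∈ ν`. This makes the
quotient map injective on `hat A a`. -/
theorem eq_of_domLE_of_mem {μ ν : MaxFilter A} {a : A} (hμ : a ∈ μ.1) (hν : a ∈ ν.1)
    (H : DomLE A ν.1 μ.1) : μ = ν := by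
  refine Subtype.ext (μ.2.eq_of_subset ν.2.prop fun f hf => ?_)
  have h1 := H _ ((h.maxFilter_meet_mem_iff μ _ _).2 ⟨hf, hμ⟩) a hν
  refine h.maxFilter_mem_of_le ν ?_ h1
  rw [h.map_rest, h.map_meet]
  rintro p ⟨⟨q, hq, e⟩, hp⟩
  rw [← h.injOn a hq.2 hp e]
  exact hq.1

theorem exists_disjoint_of_not_domLE {μ ν : MaxFilter A} (H : ¬ DomLE A μ.1 ν.1) :
    ∃ a ∈ μ.1, ∃ b ∈ ν.1, ∀ p ∈ θ a, ∀ q ∈ θ b, d p ≠ d q := by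
  simp only [DomLE, not_forall] at H
  obtain ⟨g, hg, f, hf, hgf⟩ := H
  -- The element `f - (g ▷ f)` keeps exactly the part of `f` outside the domain of `g`.
  refine ⟨_, (h.maxFilter_diff_mem_iff μ _ _).2 ⟨hf, hgf⟩, g, hg, ?_⟩
  rw [h.map_diff, h.map_rest]
  rintro p ⟨hp, hp'⟩ q hq e
  exact hp' ⟨⟨q, hq, e.symm⟩, hp⟩

theorem not_domLE_of_disjoint {μ ν : MaxFilter A} {a b : A} (ha : a ∈ μ.1) (hb : b ∈ ν.1)
    (hab : ∀ p ∈ θ a, ∀ q ∈ θ b, d p ≠ d q) : ¬ DomLE A μ.1 ν.1 := by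
  intro H
  obtain ⟨p, hp⟩ := h.maxFilter_nonempty μ (H b hb a ha)
  rw [h.map_rest] at hp
  obtain ⟨⟨q, hq, e⟩, hp⟩ := hp
  exact hab p hp q hq e.symm

/-- A maximal filter that contains `a ▷ b` is equivalent to one that contains `a`. -/
theorem exists_approx_of_rest_mem (hA : A.IsDifferenceRestriction) {μ : MaxFilter A} {a b : A}
    (hab : A.rest a b ∈ μ.1) : ∃ ν : MaxFilter A, a ∈ ν.1 ∧ approx A hA ν μ := by
  -- `N` is `μ` transported to `a`: the filter generated by the restrictions of `a` to the domains
  -- of members of `μ`.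
  let N : Set A := {x | ∃ f ∈ μ.1, A.rest f a ≤ x}
  have hmono : ∀ f g : A, θ f ⊆ θ g → θ (A.rest f a) ⊆ θ (A.rest g a) := by
    intro f g hfg
    rw [h.map_rest, h.map_rest]
    exact Set.inter_subset_inter_left _ (Set.preimage_mono (Set.image_mono hfg))
  have hN : IsFilter A N := by
    refine ⟨⟨_, _, hab, (h.le_iff _ _).2 subset_rfl⟩, ?_, ?_⟩
    · rintro x y hxy ⟨f, hf, hfx⟩
      refine ⟨f, hf, ?_⟩
      rw [h.le_iff] at *
      exact hfx.trans hxy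
    · rintro x ⟨f, hf, hfx⟩ y ⟨g, hg, hgy⟩
      refine ⟨_, ⟨A.meet f g, (h.maxFilter_meet_mem_iff μ _ _).2 ⟨hf, hg⟩,
        (h.le_iff _ _).2 subset_rfl⟩, ?_, ?_⟩
      all_goals rw [h.le_iff] at *
      · refine (hmono _ _ ?_).trans hfx
        rw [h.map_meet]
        exact Set.inter_subset_left
      · refine (hmono _ _ ?_).trans hgy
        rw [h.map_meet]
        exact Set.inter_subset_right
  have hne : ∀ x ∈ N, (θ x).Nonempty := by
    rintro x ⟨f, hf, hfx⟩
    rw [h.le_iff, h.map_rest] at hfx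
    obtain ⟨p, hp⟩ := h.maxFilter_nonempty μ ((h.maxFilter_meet_mem_iff μ _ _).2 ⟨hf, hab⟩)
    rw [h.map_meet, h.map_rest] at hp
    obtain ⟨hpf, ⟨q, hq, e⟩, -⟩ := hp
    exact ⟨q, hfx ⟨⟨p, hpf, e.symm⟩, hq⟩⟩
  have hmax : Maximal (fun F : Set A => IsFilter A F ∧ F ≠ Set.univ) N := by
    refine (h.maximal_iff N).2 ⟨hN, hne, ?_⟩
    rintro x ⟨f, hf, hfx⟩ c
    rw [h.le_iff, h.map_rest] at hfx
    -- Whether `N` chooses `x · c` or `x - c` is decided by whether `μ` lives on the domain of `x ·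
    -- c`.
    by_cases hm : A.rest (A.meet x c) f ∈ μ.1
    · left
      refine ⟨_, (h.maxFilter_meet_mem_iff μ _ _).2 ⟨hm, hf⟩, ?_⟩
      rw [h.le_iff]
      simp only [h.map_rest, h.map_meet]
      rintro p ⟨⟨q, ⟨⟨⟨r, ⟨hrx, hrc⟩, hrq⟩, -⟩, hqf⟩, hqp⟩, hpa⟩
      have hpx := hfx ⟨⟨q, hqf, hqp⟩, hpa⟩
      obtain rfl := h.injOn x hrx hpx (hrq.trans hqp)
      exact ⟨hrx, hrc⟩
    · right
      refine ⟨_, (h.maxFilter_diff_mem_iff μ _ _).2 ⟨hf, hm⟩, ?_⟩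
      rw [h.le_iff]
      simp only [h.map_rest, h.map_meet, h.map_diff]
      rintro p ⟨⟨q, ⟨hqf, hqn⟩, hqp⟩, hpa⟩
      have hpx := hfx ⟨⟨q, hqf, hqp⟩, hpa⟩
      exact ⟨hpx, fun hpc => hqn ⟨⟨p, ⟨hpx, hpc⟩, hqp.symm⟩, hqf⟩⟩
  refine ⟨⟨N, hmax⟩, ⟨_, hab, ?_⟩, ?_, ?_⟩
  · rw [h.le_iff, h.map_rest]
    exact Set.inter_subset_right
  · rintro g hg x ⟨f, hf, hfx⟩
    refine ⟨_, (h.maxFilter_meet_mem_iff μ _ _).2 ⟨hf, hg⟩, ?_⟩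
    rw [h.le_iff] at *
    simp only [h.map_rest, h.map_meet] at *
    rintro p ⟨⟨q, ⟨hqf, hqg⟩, e⟩, hpa⟩
    exact ⟨⟨q, hqg, e⟩, hfx ⟨⟨q, hqf, e⟩, hpa⟩⟩
  · rintro x ⟨f, hf, hfx⟩ g hg
    refine h.maxFilter_mem_of_le μ (a := A.meet (A.meet f g) (A.rest a b)) ?_ ?_
    · rw [h.le_iff] at *
      simp only [h.map_rest, h.map_meet] at *
      rintro p ⟨⟨hpf, hpg⟩, ⟨q, hqa, e⟩, -⟩
      exact ⟨⟨q, hfx ⟨⟨p, hpf, e.symm⟩, hqa⟩, e⟩, hpg⟩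
    · simp only [h.maxFilter_meet_mem_iff]
      exact ⟨⟨hf, hg⟩, hab⟩

end PointRep

theorem update_mem {ι : Type*} [DecidableEq ι] {α : Type*} {F : ι → Set α}
    {a : ι → α} {k : ι} {S : Set α} {c : α} (ha : ∀ i, a i ∈ F i) (hc : c ∈ S) (i : ι) :
    Function.update a k c i ∈ Function.update F k S i := by
  rcases eq_or_ne i k with rfl | hi
  · simpa using hc
  · simpa [hi] using ha i

/-! ### The space of maximal filters -/

theorem isOpen_hat (A : Alg.{u, w} σ) (a : A) : IsOpen (hat A a) :=
  TopologicalSpace.isOpen_generateFrom_of_mem ⟨a, rfl⟩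

namespace PointRep

variable {A : Alg.{u, w} σ} {P D : Type*} {d : P → D} {θ : A → Set P} (h : PointRep A d θ)
include h

theorem isTopologicalBasis_hat :
    TopologicalSpace.IsTopologicalBasis (Set.range (hat A)) where
  exists_subset_inter := by
    rintro _ ⟨a, rfl⟩ _ ⟨b, rfl⟩ μ hμ
    exact ⟨_, ⟨A.meet a b, rfl⟩, (h.maxFilter_meet_mem_iff μ a b).2 hμ,
      fun ν hν => (h.maxFilter_meet_mem_iff ν a b).1 hν⟩
  sUnion_eq := by
    refine Set.eq_univ_of_forall fun μ => ?_
    obtain ⟨a, ha⟩ := μ.2.prop.1.nonempty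
    exact ⟨_, ⟨a, rfl⟩, ha⟩
  eq_generateFrom := rfl

/-- An ultrafilter `𝒰` on the space that contains `hat A a` converges to the maximal filter `{b |
hat A b ∈ 𝒰}`. -/
theorem isCompact_hat (a : A) : IsCompact (hat A a) := by
  rw [isCompact_iff_ultrafilter_le_nhds]
  intro 𝒰 h𝒰
  rw [Filter.le_principal_iff] at h𝒰
  have hmax : Maximal (fun F : Set A => IsFilter A F ∧ F ≠ Set.univ) {b | hat A b ∈ 𝒰} := by
    rw [h.maximal_iff]
    refine ⟨⟨⟨a, h𝒰⟩, fun b c hbc hb => ?_, fun b hb c hc => ⟨A.meet b c, ?_, ?_, ?_⟩⟩,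
      fun b hb => ?_, fun b hb c => ?_⟩
    · exact Filter.mem_of_superset hb fun μ hμ => μ.2.prop.1.mem_of_le b c hbc hμ
    · refine Filter.mem_of_superset (Filter.inter_mem hb hc) fun μ hμ => ?_
      exact (h.maxFilter_meet_mem_iff μ b c).2 hμ
    · rw [h.le_iff, h.map_meet]
      exact Set.inter_subset_left
    · rw [h.le_iff, h.map_meet]
      exact Set.inter_subset_right
    · obtain ⟨μ, hμ⟩ := 𝒰.nonempty_of_mem hb
      exact h.maxFilter_nonempty μ hμ
    · refine Ultrafilter.union_mem_iff.1 (Filter.mem_of_superset hb fun μ hμ => ?_)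
      exact ((h.maximal_iff _).1 μ.2).2.2 b hμ c
  let μ : MaxFilter A := ⟨_, hmax⟩
  have hnhds : nhds μ = ⨅ s ∈ {s | μ ∈ s ∧ s ∈ Set.range (hat A)}, Filter.principal s :=
    TopologicalSpace.nhds_generateFrom
  refine ⟨μ, h𝒰, ?_⟩
  rw [hnhds]
  refine le_iInf₂ fun s hs => ?_
  obtain ⟨hμ, b, rfl⟩ := hs
  exact Filter.le_principal_iff.2 hμ

theorem t2Space_maxFilter : T2Space (MaxFilter A) := by
  refine ⟨fun μ ν hne => ?_⟩
  have : ∃ a ∈ μ.1, a ∉ ν.1 := by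
    by_contra! hsub
    exact hne (Subtype.ext (μ.2.eq_of_subset ν.2.prop hsub))
  obtain ⟨a, ha, ha'⟩ := this
  obtain ⟨b, hb⟩ := ν.2.prop.1.nonempty
  refine ⟨hat A a, hat A (A.diff b a), isOpen_hat A _, isOpen_hat A _, ha,
    (h.maxFilter_diff_mem_iff ν _ _).2 ⟨hb, ha'⟩, ?_⟩
  rw [Set.disjoint_left]
  exact fun ξ hξ hξ' => ((h.maxFilter_diff_mem_iff ξ _ _).1 hξ').2 hξ

theorem eq_biUnion_hat_of_isOpen {U : Set (MaxFilter A)}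
    (hU : IsOpen U) : U = ⋃ a ∈ {a | hat A a ⊆ U}, hat A a := by
  refine Set.Subset.antisymm (fun μ hμ => ?_) (Set.iUnion₂_subset fun a ha => ha)
  obtain ⟨_, ⟨a, rfl⟩, ha, haU⟩ := h.isTopologicalBasis_hat.exists_subset_of_mem_open hμ hU
  exact Set.mem_biUnion (show a ∈ {a | hat A a ⊆ U} from haU) ha

theorem exists_finite_biUnion_hat {U : Set (MaxFilter A)} (hc : IsCompact U) (hU : IsOpen U) :
    ∃ T : Set A, T.Finite ∧ U = ⋃ a ∈ T, hat A a := by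
  obtain ⟨T, hT, hfin, hcov⟩ := hc.elim_finite_subcover_image (b := {a | hat A a ⊆ U})
    (fun a _ => isOpen_hat A a) (h.eq_biUnion_hat_of_isOpen hU).subset
  exact ⟨T, hfin, hcov.antisymm (Set.iUnion₂_subset fun a ha => hT ha)⟩

theorem hat_diff (a b : A) : hat A (A.diff a b) = hat A a \ hat A b :=
  Set.ext fun μ => h.maxFilter_diff_mem_iff μ a b

/-! ### The quotient by the domain equivalence -/

variable (hA : A.IsDifferenceRestriction)

theorem hat_rest (a b : A) : hat A (A.rest a b) =
    (Quotient.mk (approx A hA)) ⁻¹' ((Quotient.mk (approx A hA)) '' hat A a) ∩ hat A b := by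
  ext μ
  constructor
  · intro hμ
    obtain ⟨ν, hν, e⟩ := h.exists_approx_of_rest_mem hA hμ
    refine ⟨⟨ν, hν, Quotient.sound e⟩, h.maxFilter_mem_of_le μ ?_ hμ⟩
    rw [h.map_rest]
    exact Set.inter_subset_right
  · rintro ⟨⟨ν, hν, e⟩, hμ⟩
    exact (Quotient.exact e).2 a hν b hμ

/-- Every maximal filter contains some `b`, so the saturation of a basic open set is a union of
basic open sets; hence the quotient map is open. -/
theorem preimage_image_hat (a : A) :
    (Quotient.mk (approx A hA)) ⁻¹' ((Quotient.mk (approx A hA)) '' hat A a) =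
      ⋃ b, hat A (A.rest a b) := by
  ext μ
  simp only [h.hat_rest hA, ← Set.inter_iUnion, Set.mem_inter_iff, iff_self_and]
  intro _
  obtain ⟨b, hb⟩ := μ.2.prop.1.nonempty
  exact Set.mem_iUnion.2 ⟨b, hb⟩

theorem isOpenMap_mk : IsOpenMap (Quotient.mk (approx A hA)) := by
  rw [h.isTopologicalBasis_hat.isOpenMap_iff]
  rintro _ ⟨a, rfl⟩
  rw [← isQuotientMap_quotient_mk'.isOpen_preimage]
  change IsOpen ((Quotient.mk (approx A hA)) ⁻¹' ((Quotient.mk (approx A hA)) '' hat A a))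
  rw [h.preimage_image_hat hA]
  exact isOpen_iUnion fun b => isOpen_hat A _

theorem injOn_mk_hat (a : A) : Set.InjOn (Quotient.mk (approx A hA)) (hat A a) :=
  fun _ hμ _ hν e => h.eq_of_domLE_of_mem hμ hν (Quotient.exact e).2

theorem isLocalHomeomorph_mk : IsLocalHomeomorph (Quotient.mk (approx A hA)) := by
  rw [isLocalHomeomorph_iff_isOpenEmbedding_restrict]
  intro μ
  obtain ⟨a, ha⟩ := μ.2.prop.1.nonempty
  refine ⟨hat A a, (isOpen_hat A a).mem_nhds ha, ?_⟩
  exact .of_continuous_injective_isOpenMap (continuous_quotient_mk'.comp continuous_subtype_val)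
    (Set.injOn_iff_injective.1 (h.injOn_mk_hat hA a)) ((h.isOpenMap_mk hA).domRestrict (isOpen_hat A a))

theorem exists_disjoint_of_mk_ne {μ ν : MaxFilter A}
    (hne : Quotient.mk (approx A hA) μ ≠ Quotient.mk (approx A hA) ν) :
    ∃ a ∈ μ.1, ∃ b ∈ ν.1, ∀ p ∈ θ a, ∀ q ∈ θ b, d p ≠ d q := by
  have : ¬ (DomLE A μ.1 ν.1 ∧ DomLE A ν.1 μ.1) := fun H => hne (Quotient.sound H)
  rw [not_and_or] at this
  rcases this with H | H
  · exact h.exists_disjoint_of_not_domLE H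
  · obtain ⟨b, hb, a, ha, hba⟩ := h.exists_disjoint_of_not_domLE H
    exact ⟨a, ha, b, hb, fun p hp q hq => (hba q hq p hp).symm⟩

theorem t2Space_quotient : T2Space (Quotient (approx A hA)) := by
  refine ⟨fun x y => Quotient.inductionOn₂ x y fun μ ν hne => ?_⟩
  obtain ⟨a, ha, b, hb, hab⟩ := h.exists_disjoint_of_mk_ne hA hne
  refine ⟨_, _, h.isOpenMap_mk hA _ (isOpen_hat A a), h.isOpenMap_mk hA _ (isOpen_hat A b),
    ⟨μ, ha, rfl⟩, ⟨ν, hb, rfl⟩, ?_⟩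
  rw [Set.disjoint_left]
  rintro _ ⟨ξ, hξ, rfl⟩ ⟨ζ, hζ, e⟩
  exact h.not_domLE_of_disjoint hξ hζ hab (Quotient.exact e).2

/-! ### Operators and relations -/

variable {n : ℕ} {Ω : (Fin n → A) → A} (hadd : A.Additive Ω) (hnor : A.Normal Ω)
include hadd

theorem op_update_mono (a : Fin n → A) (i : Fin n) {b c : A} (hbc : θ b ⊆ θ c) :
    θ (Ω (Function.update a i b)) ⊆ θ (Ω (Function.update a i c)) := by
  have := hadd i a b c c ((h.isLUB_pair_iff _ _ _).2 (Set.union_eq_right.2 hbc).symm)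
  exact (h.le_iff _ _).1 (this.1 (Or.inl rfl))

/-- Additivity yields monotonicity in a single argument; the arguments are then exchanged one by
one. -/
theorem op_mono {a b : Fin n → A} (hab : ∀ i, θ (a i) ⊆ θ (b i)) : θ (Ω a) ⊆ θ (Ω b) := by
  have key : ∀ I : Finset (Fin n), θ (Ω a) ⊆ θ (Ω (I.piecewise b a)) := by
    intro I
    induction I using Finset.induction_on with
    | empty => simp
    | insert k I hk ih =>
      refine ih.trans ?_
      have e : I.piecewise b a = Function.update (I.piecewise b a) k (a k) := by
        rw [Function.eq_update_self_iff]
        simp [hk]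
      rw [Finset.piecewise_insert]
      nth_rewrite 1 [e]
      exact h.op_update_mono hadd _ _ (hab k)
  simpa using key Finset.univ

include hnor

/-- A filter in one coordinate can be replaced by a maximal filter. -/
theorem exists_maxFilter_update {F : Fin n → Set A} (hF : ∀ i, IsFilter A (F i))
    (ν : MaxFilter A) (hΩ : ∀ a, (∀ i, a i ∈ F i) → Ω a ∈ ν.1) (k : Fin n) {c : A}
    (hc : c ∈ F k) :
    ∃ μ : MaxFilter A, c ∈ μ.1 ∧
      ∀ a, (∀ i, a i ∈ Function.update F k μ.1 i) → Ω a ∈ ν.1 := by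
  -- `J` is the ideal of elements below `c` that must not belong to the maximal filter
  let J : Set A := {x | θ x ⊆ θ c ∧ ∃ b, (∀ i, b i ∈ F i) ∧ Ω (Function.update b k x) ∉ ν.1}
  have hbot : ∀ x, θ x = ∅ → x ∈ J := by
    intro x hx
    choose b hb using fun i => (hF i).nonempty
    refine ⟨by simp [hx], b, hb, fun hm => ?_⟩
    rw [hnor k b x ((h.isBot_iff x).2 hx)] at hm
    simpa [hx] using h.maxFilter_nonempty ν hm
  have hsup : ∀ x ∈ J, ∀ y ∈ J, ∀ s, θ s = θ x ∪ θ y → s ∈ J := by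
    rintro x ⟨hx, b, hb, hbx⟩ y ⟨hy, b', hb', hby⟩ s hs
    refine ⟨hs ▸ Set.union_subset hx hy, fun i => A.meet (b i) (b' i),
      fun i => h.meet_mem_of_isFilter (hF i) (hb i) (hb' i), fun hm => ?_⟩
    have hlub := hadd k (fun i => A.meet (b i) (b' i)) x y s ((h.isLUB_pair_iff _ _ _).2 hs)
    have hcov := ((h.isLUB_iff (Set.toFinite _) _).1 hlub).subset
    -- Additivity splits the value at `s` in two, and primeness of `ν` selects a half; either choice
    -- contradicts membership of `x` or `y` in `J`.
    obtain ⟨t, ht, htν⟩ := h.maxFilter_prime ν hm (Set.toFinite _) hcov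
    have hle : ∀ g : Fin n → A, (∀ i, θ (A.meet (b i) (b' i)) ⊆ θ (g i)) → ∀ z,
        θ (Ω (Function.update (fun i => A.meet (b i) (b' i)) k z)) ⊆
          θ (Ω (Function.update g k z)) := by
      intro g hg z
      refine h.op_mono hadd fun i => ?_
      rcases eq_or_ne i k with rfl | hi
      · simp
      · simpa [hi] using hg i
    rcases ht with rfl | rfl
    · refine hbx (h.maxFilter_mem_of_le ν (hle b (fun i => ?_) x) htν)
      rw [h.map_meet]
      exact Set.inter_subset_left
    · refine hby (h.maxFilter_mem_of_le ν (hle b' (fun i => ?_) y) htν)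
      rw [h.map_meet]
      exact Set.inter_subset_right
  have hfin : ∀ T : Set A, T.Finite → T ⊆ J → ∃ s ∈ J, θ s = ⋃ t ∈ T, θ t := by
    intro T hT
    induction T, hT using Set.Finite.induction_on with
    | empty =>
      intro _
      refine ⟨A.diff c c, hbot _ ?_, ?_⟩ <;> simp [h.map_diff]
    | @insert x S _ _ ih =>
      intro hsub
      obtain ⟨s, hs, e⟩ := ih fun t ht => hsub (Set.mem_insert_of_mem _ ht)
      have hx := hsub (Set.mem_insert _ _)
      obtain ⟨r, hr⟩ := h.exists_union_of_le ((h.le_iff x c).2 hx.1) ((h.le_iff s c).2 hs.1)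
      exact ⟨r, hsup x hx s hs r hr, by rw [hr, e, Set.biUnion_insert]⟩
  have hcJ : c ∉ J := by
    rintro ⟨-, b, hb, hm⟩
    refine hm (hΩ _ fun i => ?_)
    rw [← Function.update_eq_self k F]
    exact update_mem hb hc i
  -- Prime ideal argument by compactness: otherwise finitely many members of `J` cover `hat A c`,
  -- and their join, which is `c`, lies in `J`.
  have hex : ∃ μ : MaxFilter A, c ∈ μ.1 ∧ ∀ x ∈ J, x ∉ μ.1 := by
    by_contra! hcon
    obtain ⟨T, hTJ, hT, hcov⟩ := (h.isCompact_hat c).elim_finite_subcover_image (b := J)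
      (fun a _ => isOpen_hat A a) (fun μ hμ => by
        obtain ⟨x, hx, hxμ⟩ := hcon μ hμ
        exact Set.mem_biUnion hx hxμ)
    obtain ⟨s, hs, e⟩ := hfin T hT hTJ
    have hsc : θ s = θ c := hs.1.antisymm (e ▸ h.subset_biUnion_of_hat hcov)
    exact hcJ (h.injective hsc ▸ hs)
  obtain ⟨μ, hcμ, hμ⟩ := hex
  refine ⟨μ, hcμ, fun a ha => ?_⟩
  by_contra hcon
  have hak : a k ∈ μ.1 := by simpa using ha k
  -- Members of `J` lie below `c`, so `a k` is cut down to `c`. Position `k` of the witness tuple is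
  -- overwritten afterwards; `c` is put there because it belongs to `F k`.
  refine hμ (A.meet (a k) c) ⟨?_, Function.update a k c, fun i => ?_, fun hm => hcon ?_⟩
    ((h.maxFilter_meet_mem_iff μ _ _).2 ⟨hak, hcμ⟩)
  · rw [h.map_meet]
    exact Set.inter_subset_right
  · have := update_mem (k := k) ha hc i
    simpa using this
  · rw [Function.update_idem] at hm
    have hle := h.op_update_mono hadd a k (b := A.meet (a k) c) (c := a k)
      (by rw [h.map_meet]; exact Set.inter_subset_left)
    rw [Function.update_eq_self] at hle
    exact h.maxFilter_mem_of_le ν hle hm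

/-- Starting from the principal filters of the `a i`, which satisfy the condition by monotonicity,
each coordinate is enlarged to a maximal filter while the others stay fixed. -/
theorem exists_relOfOp {a : Fin n → A} {ν : MaxFilter A} (ha : Ω a ∈ ν.1) :
    ∃ μ : Fin n → MaxFilter A, (∀ i, a i ∈ (μ i).1) ∧ relOfOp A Ω μ ν := by
  have key : ∀ I : Finset (Fin n), ∃ F : Fin n → Set A, (∀ i, IsFilter A (F i)) ∧
      (∀ i, a i ∈ F i) ∧ (∀ b, (∀ i, b i ∈ F i) → Ω b ∈ ν.1) ∧
      ∀ i ∈ I, Maximal (fun F : Set A => IsFilter A F ∧ F ≠ Set.univ) (F i) := by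
    intro I
    induction I using Finset.induction_on with
    | empty =>
      refine ⟨fun i => {b | θ (a i) ⊆ θ b}, fun i => ⟨⟨a i, Set.Subset.refl _⟩, ?_, ?_⟩,
        fun i => Set.Subset.refl _, fun b hb => h.maxFilter_mem_of_le ν (h.op_mono hadd hb) ha, by simp⟩
      · intro b c hbc hb
        exact Set.Subset.trans hb ((h.le_iff _ _).1 hbc)
      · intro b hb c hc
        exact ⟨a i, Set.Subset.refl _, (h.le_iff _ _).2 hb, (h.le_iff _ _).2 hc⟩
    | insert k I hk ih =>
      obtain ⟨F, hF, haF, hΩ, hI⟩ := ih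
      obtain ⟨μ, haμ, hμ⟩ := h.exists_maxFilter_update hadd hnor hF ν hΩ k (haF k)
      refine ⟨Function.update F k μ.1, fun i => ?_, fun i => ?_, hμ, fun i hi => ?_⟩
      · rcases eq_or_ne i k with rfl | hik
        · simpa using μ.2.prop.1
        · simpa [hik] using hF i
      · simpa using update_mem (k := k) haF haμ i
      · rcases eq_or_ne i k with rfl | hik
        · simpa using μ.2
        · simpa [hik] using hI i (Finset.mem_of_mem_insert_of_ne hi hik)
  obtain ⟨F, -, haF, hΩ, hI⟩ := key Finset.univ
  exact ⟨fun i => ⟨F i, hI i (Finset.mem_univ i)⟩, haF, hΩ⟩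

theorem hat_op (a : Fin n → A) : hat A (Ω a) = opOfRel (relOfOp A Ω) fun i => hat A (a i) := by
  ext ν
  constructor
  · intro hν
    exact h.exists_relOfOp hadd hnor hν
  · rintro ⟨μ, hμ, hR⟩
    exact hR a hμ

theorem opOfRel_biUnion_hat (T : Fin n → Set A) :
    opOfRel (relOfOp A Ω) (fun i => ⋃ a ∈ T i, hat A a) =
      ⋃ a ∈ Set.univ.pi T, hat A (Ω a) := by
  ext ν
  simp only [h.hat_op hadd hnor, Set.mem_iUnion₂]
  constructor
  · rintro ⟨μ, hμ, hR⟩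
    choose a ha haμ using fun i => Set.mem_iUnion₂.1 (hμ i)
    exact ⟨a, fun i _ => ha i, μ, haμ, hR⟩
  · rintro ⟨a, ha, μ, hμ, hR⟩
    exact ⟨μ, fun i => Set.mem_biUnion (ha i trivial) (hμ i), hR⟩

theorem spectralRel_relOfOp : SpectralRel (relOfOp A Ω) := by
  have hopen : ContinuousRel (relOfOp A Ω) := by
    intro S hS
    have : S = fun i => ⋃ a ∈ {a | hat A a ⊆ S i}, hat A a :=
      funext fun i => h.eq_biUnion_hat_of_isOpen (hS i)
    rw [this, h.opOfRel_biUnion_hat hadd hnor]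
    exact isOpen_biUnion fun a _ => isOpen_hat A _
  refine ⟨hopen, fun S hS => ⟨?_, hopen S fun i => (hS i).2⟩⟩
  choose T hT hST using fun i => h.exists_finite_biUnion_hat (hS i).1 (hS i).2
  rw [funext hST, h.opOfRel_biUnion_hat hadd hnor]
  exact (Set.Finite.pi hT).isCompact_biUnion
    fun a _ => h.isCompact_hat _

omit hadd hnor in
theorem tightRel_relOfOp : TightRel (relOfOp A Ω) := by
  intro μ ν H a ha
  obtain ⟨μ', hμ', hR⟩ := H (fun i => hat A (a i))
    (fun i => ⟨h.isCompact_hat _, isOpen_hat A _⟩) ha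
  exact hR a hμ'

omit hadd hnor in
theorem compatibilityProperty_relOfOp (hcomp : A.CompatibilityPreserving Ω) :
    CompatibilityProperty (Quotient.mk (approx A hA)) (relOfOp A Ω) := by
  intro μ μ' ν ν' hμ hR hR' e
  -- Compatible points have compatible witnesses: a common element if the filters coincide, elements
  -- with disjoint domains if their classes differ.
  have hex : ∀ i, ∃ a a' : A, a ∈ (μ i).1 ∧ a' ∈ (μ' i).1 ∧ A.Compatible a a' := by
    intro i
    by_cases hi : Quotient.mk (approx A hA) (μ i) = Quotient.mk (approx A hA) (μ' i)
    · obtain ⟨a, ha⟩ := (μ i).2.prop.1.nonempty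
      exact ⟨a, a, ha, hμ i hi ▸ ha, rfl⟩
    · obtain ⟨a, ha, b, hb, hab⟩ := h.exists_disjoint_of_mk_ne hA hi
      exact ⟨a, b, ha, hb, (h.compatible_iff a b).2 fun p hp q hq e => absurd e (hab p hp q hq)⟩
  choose a a' ha ha' hc using hex
  have h1 := (Quotient.exact e).1 _ (hR' a' ha') _ (hR a ha)
  have h2 := (Quotient.exact e).2 _ (hR a ha) _ (hR' a' ha')
  -- The two restrictions agree, so `ν` and `ν'` share an element; equivalent filters with a common
  -- element are equal.
  rw [hcomp a a' hc] at h2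
  exact h.eq_of_domLE_of_mem h1 h2 (Quotient.exact e).2

end PointRep

/-! ### The algebra of compact open sets -/

namespace RelMap.IsHausEt

variable {E : RelMap.{u, w} σ} (hE : E.IsHausEt)
include hE

theorem pointRep_gObj : PointRep (GObj E hE) E.π (fun U => U.1) where
  injOn U := U.2.2.2
  injective := Subtype.val_injective
  map_diff _ _ := rfl
  map_rest _ _ := rfl

theorem compatibilityPreserving_gObj (s : σ.Symbol) :
    (GObj E hE).CompatibilityPreserving ((GObj E hE).op s) := by
  intro U V hUV
  simp only [hE.pointRep_gObj.compatible_iff] at hUV ⊢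
  rintro y ⟨x, hx, hxy⟩ y' ⟨x', hx', hxy'⟩ e
  exact hE.compatibilityProperty s x x' y y'
    (fun i => hUV i _ (hx i) _ (hx' i)) hxy hxy' e

theorem normal_gObj (s : σ.Symbol) : (GObj E hE).Normal ((GObj E hE).op s) := by
  intro i U Z hZ
  have hZ' := (hE.pointRep_gObj.isBot_iff Z).1 hZ
  refine hE.pointRep_gObj.injective (Eq.trans ?_ hZ'.symm)
  rw [Set.eq_empty_iff_forall_notMem]
  rintro y ⟨x, hx, -⟩
  have : x i ∈ (Function.update U i Z i).1 := hx i
  rw [Function.update_self, hZ'] at this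
  exact this

/-- Existing joins are unions, and the existential defining `opOfRel` distributes over a union in
one coordinate. -/
theorem additive_gObj (s : σ.Symbol) : (GObj E hE).Additive ((GObj E hE).op s) := by
  intro i U V W S hS
  rw [hE.pointRep_gObj.isLUB_pair_iff] at hS ⊢
  have hval : ∀ Z : GObj E hE, ((GObj E hE).op s (Function.update U i Z)).1 =
      {y | ∃ x : Fin (σ.arity s) → E.X,
        (x i ∈ Z.1 ∧ ∀ j ≠ i, x j ∈ (U j).1) ∧ E.rel s x y} := by
    intro Z
    ext y
    refine exists_congr fun x => and_congr_left fun _ => ?_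
    rw [Function.forall_update_iff U (fun j z => x j ∈ z.1)]
  rw [hval, hval, hval, hS]
  ext y
  constructor
  · rintro ⟨x, ⟨hx | hx, hU⟩, hR⟩
    · exact Or.inl ⟨x, ⟨hx, hU⟩, hR⟩
    · exact Or.inr ⟨x, ⟨hx, hU⟩, hR⟩
  · rintro (⟨x, ⟨hx, hU⟩, hR⟩ | ⟨x, ⟨hx, hU⟩, hR⟩)
    · exact ⟨x, ⟨Or.inl hx, hU⟩, hR⟩
    · exact ⟨x, ⟨Or.inr hx, hU⟩, hR⟩

theorem isDRA_gObj : (GObj E hE).IsDRA where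
  isDifferenceRestriction := hE.pointRep_gObj.isDifferenceRestriction
  compatibilityPreserving := hE.compatibilityPreserving_gObj
  normal := hE.normal_gObj
  additive := hE.additive_gObj

theorem complete_gObj : (GObj E hE).FinitarilyCompatiblyComplete := by
  intro S hS hcomp
  simp only [hE.pointRep_gObj.compatible_iff] at hcomp
  have hKO : E.IsKO (⋃ U ∈ S, U.1) := by
    refine ⟨hS.isCompact_biUnion fun U _ => U.2.1, isOpen_biUnion fun U _ => U.2.2.1, ?_⟩
    intro x hx y hy e
    obtain ⟨U, hU, hxU⟩ := Set.mem_iUnion₂.1 hx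
    obtain ⟨V, hV, hyV⟩ := Set.mem_iUnion₂.1 hy
    exact hcomp U hU V hV x hxU y hyV e
  exact ⟨⟨_, hKO⟩, (hE.pointRep_gObj.isLUB_iff hS _).2 rfl⟩

end RelMap.IsHausEt

/-! ### The unit -/

section Unit

variable {A : Alg.{u, w} σ} (hA : A.IsDRA)

theorem exists_pointRep {A : Alg.{u, w} σ} (hA : A.IsDifferenceRestriction) :
    ∃ (P D : Type u) (d : P → D) (θ : A → Set P), PointRep A d θ := by
  obtain ⟨X, Y, θ, hθ⟩ := hA
  exact ⟨_, _, _, _, hθ.pointRep⟩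

theorem isHausEt_fObj : (FObj A hA).IsHausEt := by
  obtain ⟨P, D, d, θ, h⟩ := exists_pointRep hA.isDifferenceRestriction
  exact
    { t2X := h.t2Space_maxFilter
      t2X₀ := h.t2Space_quotient hA.isDifferenceRestriction
      isLocalHomeomorph := h.isLocalHomeomorph_mk hA.isDifferenceRestriction
      surjective := Quotient.mk_surjective
      compatibilityProperty := fun s =>
        h.compatibilityProperty_relOfOp _ (hA.compatibilityPreserving s)
      spectral := fun s => h.spectralRel_relOfOp (hA.additive s) (hA.normal s)
      tight := fun s => h.tightRel_relOfOp }

theorem isKO_hat (a : A) : (FObj A hA).IsKO (hat A a) := by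
  obtain ⟨P, D, d, θ, h⟩ := exists_pointRep hA.isDifferenceRestriction
  exact ⟨h.isCompact_hat a, isOpen_hat A a, h.injOn_mk_hat hA.isDifferenceRestriction a⟩

/-- The embedding of an algebra into the algebra of compact open sets of its space of maximal
filters. -/
def unit (a : A) : GObj (FObj A hA) (isHausEt_fObj hA) := ⟨hat A a, isKO_hat hA a⟩

theorem isHom_unit : Alg.IsHom A (GObj (FObj A hA) (isHausEt_fObj hA)) (unit hA) := by
  obtain ⟨P, D, d, θ, h⟩ := exists_pointRep hA.isDifferenceRestriction
  exact ⟨fun a b => Subtype.ext (h.hat_diff a b),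
    fun a b => Subtype.ext (h.hat_rest hA.isDifferenceRestriction a b),
    fun s a => Subtype.ext (h.hat_op (hA.additive s) (hA.normal s) a)⟩

theorem injective_unit : Function.Injective (unit hA) := by
  obtain ⟨P, D, d, θ, h⟩ := exists_pointRep hA.isDifferenceRestriction
  intro a b e
  have e' : hat A a = hat A b := congrArg Subtype.val e
  have hsub : ∀ {a b : A}, hat A a ⊆ hat A b → θ a ⊆ θ b := fun {a b} hab => by
    simpa using h.subset_biUnion_of_hat (a := a) (T := {b}) (by simpa using hab)
  exact h.injective ((hsub e'.subset).antisymm (hsub e'.symm.subset))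

theorem exists_finite_unit (U : GObj (FObj A hA) (isHausEt_fObj hA)) :
    ∃ T : Set A, T.Finite ∧ U.1 = ⋃ t ∈ T, hat A t := by
  obtain ⟨P, D, d, θ, h⟩ := exists_pointRep hA.isDifferenceRestriction
  exact h.exists_finite_biUnion_hat U.2.1 U.2.2.1

theorem isLUB_image_unit {U : GObj (FObj A hA) (isHausEt_fObj hA)} {T : Set A} (hT : T.Finite)
    (hU : U.1 = ⋃ t ∈ T, hat A t) : IsLUB (unit hA '' T) U := by
  rw [(isHausEt_fObj hA).pointRep_gObj.isLUB_iff (hT.image _), Set.biUnion_image]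
  exact hU

theorem isFinitaryCompatibleCompletion_unit : Alg.IsFinitaryCompatibleCompletion A
    (GObj (FObj A hA) (isHausEt_fObj hA)) (unit hA) where
  isDRA := (isHausEt_fObj hA).isDRA_gObj
  complete := (isHausEt_fObj hA).complete_gObj
  isHom := isHom_unit hA
  injective := injective_unit hA
  dense U := by
    obtain ⟨T, hT, hU⟩ := exists_finite_unit hA U
    exact ⟨_, Set.image_subset_range _ T, hT.image _, isLUB_image_unit hA hT hU⟩

end Unit

/-! ### Uniqueness of the completion -/

/-- Operators distribute over finite joins, in all arguments simultaneously. -/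
theorem PointRep.map_op_eq_biUnion {C : Alg.{v, w} σ} {P D : Type*} {d : P → D} {γ : C → Set P}
    (h : PointRep C d γ) {n : ℕ} {Ω : (Fin n → C) → C} (hadd : C.Additive Ω) (hnor : C.Normal Ω)
    {c : Fin n → C} {T : Fin n → Set C} (hT : ∀ i, (T i).Finite)
    (hc : ∀ i, γ (c i) = ⋃ t ∈ T i, γ t) :
    γ (Ω c) = ⋃ t ∈ Set.univ.pi T, γ (Ω t) := by
  refine Set.Subset.antisymm (fun p hp => ?_) (Set.iUnion₂_subset fun t ht => ?_)
  -- The point `p` is read as a maximal filter. Primeness of each related filter picks a member of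
  -- `T i`, so all arguments are treated at once.
  · obtain ⟨μ, hμ, hR⟩ := h.exists_relOfOp hadd hnor (ν := ⟨_, h.maximal_point hp⟩) hp
    choose t ht htμ using fun i => h.maxFilter_prime (μ i) (hμ i) (hT i) (hc i).subset
    exact Set.mem_iUnion₂.2 ⟨t, fun i _ => ht i, hR t htμ⟩
  · refine h.op_mono hadd fun i => ?_
    rw [hc i]
    exact Set.subset_biUnion_of_mem (u := fun t => γ t) (ht i trivial)

theorem Alg.IsHom.le_of_le {A : Alg.{u, w} σ} {B : Alg.{v, w} σ} {f : A → B}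
    (hf : Alg.IsHom A B f) {a b : A} (hab : a ≤ b) : f a ≤ f b := by
  change A.meet a b = a at hab
  change B.meet (f a) (f b) = f a
  conv_rhs => rw [← hab]
  simp only [Alg.meet, hf.map_diff]

theorem Alg.IsHom.le_iff_le {A : Alg.{u, w} σ} {B : Alg.{v, w} σ} {f : A → B}
    (hf : Alg.IsHom A B f) (inj : Function.Injective f) {a b : A} : f a ≤ f b ↔ a ≤ b := by
  refine ⟨fun hab => inj ?_, hf.le_of_le⟩
  change B.meet (f a) (f b) = f a at hab
  rw [← hab]
  simp only [Alg.meet, hf.map_diff]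

theorem Alg.IsHom.isLUB_image {A : Alg.{u, w} σ} {B : Alg.{v, w} σ} {f : A → B}
    (hf : Alg.IsHom A B f) (bij : Function.Bijective f) {S : Set A} {a : A} (ha : IsLUB S a) :
    IsLUB (f '' S) (f a) := by
  refine ⟨?_, fun b hb => ?_⟩
  · rintro _ ⟨s, hs, rfl⟩
    exact hf.le_of_le (ha.1 hs)
  · obtain ⟨b, rfl⟩ := bij.2 b
    exact hf.le_of_le (ha.2 fun s hs => (hf.le_iff_le bij.1).1 (hb ⟨s, hs, rfl⟩))

theorem Alg.IsHom.of_leftInverse {A : Alg.{u, w} σ} {B : Alg.{v, w} σ} {f : A → B} {g : B → A}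
    (hf : Alg.IsHom A B f) (inj : Function.Injective f) (hfg : ∀ b, f (g b) = b) :
    Alg.IsHom B A g where
  map_diff a b := inj (by rw [hf.map_diff, hfg, hfg, hfg])
  map_rest a b := inj (by rw [hf.map_rest, hfg, hfg, hfg])
  map_op s a := inj (by simp only [hf.map_op, hfg])

theorem preimage_image_biUnion_inter {α X Y : Type*} {f : X → Y} {r : α → α → α}
    {F G H : α → Set X} {S T : Set α} (hr : ∀ s t, H (r s t) = f ⁻¹' (f '' F s) ∩ G t) :
    f ⁻¹' (f '' ⋃ s ∈ S, F s) ∩ ⋃ t ∈ T, G t = ⋃ x ∈ Set.image2 r S T, H x := by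
  ext p
  constructor
  · rintro ⟨⟨q, hq, e⟩, hp⟩
    obtain ⟨s, hs, hqs⟩ := Set.mem_iUnion₂.1 hq
    obtain ⟨t, ht, hpt⟩ := Set.mem_iUnion₂.1 hp
    refine Set.mem_biUnion (Set.mem_image2_of_mem hs ht) ?_
    rw [hr]
    exact ⟨⟨q, hqs, e⟩, hpt⟩
  · intro hp
    obtain ⟨_, ⟨s, hs, t, ht, rfl⟩, hp⟩ := Set.mem_iUnion₂.1 hp
    rw [hr] at hp
    obtain ⟨⟨q, hqs, e⟩, hpt⟩ := hp
    exact ⟨⟨q, Set.mem_biUnion hs hqs, e⟩, Set.mem_biUnion ht hpt⟩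

/-! ### Comparison of an arbitrary completion with the compact open sets. -/

namespace Alg.IsFinitaryCompatibleCompletion

variable {A : Alg.{u, w} σ} (hA : A.IsDRA) {C : Alg.{v, w} σ} {ι : A → C}
  (hC : Alg.IsFinitaryCompatibleCompletion A C ι)

/-- The open set of maximal filters corresponding to an element of an extension. -/
def trace (ι : A → C) (c : C) : Set (MaxFilter A) := ⋃ a ∈ {a | ι a ≤ c}, hat A a

include hC

theorem exists_finite_isLUB (c : C) : ∃ T : Set A, T.Finite ∧ IsLUB (ι '' T) c := by
  obtain ⟨S, hS, hfin, hlub⟩ := hC.dense c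
  refine ⟨ι ⁻¹' S, hfin.preimage hC.injective.injOn, ?_⟩
  rwa [Set.image_preimage_eq_of_subset hS]

/-- If `ι a ≤ c`, then `T` covers `a` in the points of `C`, and maximal filters of `A` are prime for
such covers. Thus any finite representation of `c` computes its trace. -/
theorem trace_eq {T : Set A} (hT : T.Finite) {c : C} (hc : IsLUB (ι '' T) c) :
    trace ι c = ⋃ t ∈ T, hat A t := by
  obtain ⟨P, D, d, γ, h⟩ := exists_pointRep hC.isDRA.isDifferenceRestriction
  have hι := h.comp hC.isHom hC.injective
  rw [h.isLUB_iff (hT.image ι), Set.biUnion_image] at hc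
  refine Set.Subset.antisymm ?_ ?_
  · refine Set.iUnion₂_subset fun a ha μ hμ => ?_
    have ha' := (h.le_iff _ _).1 ha
    rw [hc] at ha'
    obtain ⟨t, ht, htμ⟩ := hι.maxFilter_prime μ hμ hT ha'
    exact Set.mem_biUnion ht htμ
  · refine Set.iUnion₂_subset fun t ht => ?_
    refine Set.subset_biUnion_of_mem (u := fun a => hat A a) ?_
    change ι t ≤ c
    rw [h.le_iff, hc]
    exact Set.subset_biUnion_of_mem (u := fun t => γ (ι t)) ht

theorem le_of_trace_subset {c c' : C} (hcc : trace ι c ⊆ trace ι c') : c ≤ c' := by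
  obtain ⟨P, D, d, γ, h⟩ := exists_pointRep hC.isDRA.isDifferenceRestriction
  have hι := h.comp hC.isHom hC.injective
  obtain ⟨T, hT, hc⟩ := hC.exists_finite_isLUB c
  obtain ⟨T', hT', hc'⟩ := hC.exists_finite_isLUB c'
  rw [hC.trace_eq hT hc, hC.trace_eq hT' hc'] at hcc
  rw [h.isLUB_iff (hT.image ι), Set.biUnion_image] at hc
  rw [h.isLUB_iff (hT'.image ι), Set.biUnion_image] at hc'
  rw [h.le_iff, hc, hc']
  exact Set.iUnion₂_subset fun t ht =>
    hι.subset_biUnion_of_hat ((Set.subset_biUnion_of_mem ht).trans hcc)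

theorem trace_diff (c c' : C) : trace ι (C.diff c c') = trace ι c \ trace ι c' := by
  obtain ⟨P, D, d, γ, h⟩ := exists_pointRep hC.isDRA.isDifferenceRestriction
  have hι := h.comp hC.isHom hC.injective
  ext μ
  constructor
  · intro hμ
    obtain ⟨a, ha, haμ⟩ := Set.mem_iUnion₂.1 hμ
    have ha' := (h.le_iff _ _).1 ha
    rw [h.map_diff] at ha'
    refine ⟨Set.mem_biUnion (show ι a ≤ c from ?_) haμ, fun hμ' => ?_⟩
    · exact (h.le_iff _ _).2 (ha'.trans Set.sdiff_subset)
    · obtain ⟨b, hb, hbμ⟩ := Set.mem_iUnion₂.1 hμ'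
      obtain ⟨p, hp⟩ := hι.maxFilter_nonempty μ ((hι.maxFilter_meet_mem_iff μ a b).2 ⟨haμ, hbμ⟩)
      rw [hι.map_meet] at hp
      exact (ha' hp.1).2 ((h.le_iff _ _).1 hb hp.2)
  · rintro ⟨hμ, hμ'⟩
    obtain ⟨a, ha, haμ⟩ := Set.mem_iUnion₂.1 hμ
    obtain ⟨T, hT, hc'⟩ := hC.exists_finite_isLUB c'
    rw [hC.trace_eq hT hc'] at hμ'
    rw [h.isLUB_iff (hT.image ι), Set.biUnion_image] at hc'
    -- `c'` need not come from `A`, but `a` minus the finitely many pieces of `c'` does, and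
    -- primeness puts this remainder in `μ`.
    obtain ⟨e, he⟩ := hι.exists_diff_biUnion a hT
    have heμ : e ∈ μ.1 := by
      by_contra hcon
      have hcov : γ (ι a) ⊆ ⋃ t ∈ insert e T, γ (ι t) := by
        rw [Set.biUnion_insert, he, Set.sdiff_union_self]
        exact Set.subset_union_left
      obtain ⟨t, rfl | ht, htμ⟩ := hι.maxFilter_prime μ haμ (hT.insert e) hcov
      · exact hcon htμ
      · exact hμ' (Set.mem_biUnion ht htμ)
    refine Set.mem_biUnion (show ι e ≤ _ from ?_) heμ
    rw [h.le_iff, h.map_diff, he, hc']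
    exact Set.sdiff_subset_sdiff_left ((h.le_iff _ _).1 ha)

theorem trace_rest (c c' : C) : trace ι (C.rest c c') =
    (FObj A hA).π ⁻¹' ((FObj A hA).π '' trace ι c) ∩ trace ι c' := by
  obtain ⟨P, D, d, γ, h⟩ := exists_pointRep hC.isDRA.isDifferenceRestriction
  have hι := h.comp hC.isHom hC.injective
  obtain ⟨T, hT, hc⟩ := hC.exists_finite_isLUB c
  obtain ⟨T', hT', hc'⟩ := hC.exists_finite_isLUB c'
  have hfin := Set.Finite.image2 A.rest hT hT'
  have hlub : IsLUB (ι '' Set.image2 A.rest T T') (C.rest c c') := by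
    rw [h.isLUB_iff (hT.image ι), Set.biUnion_image] at hc
    rw [h.isLUB_iff (hT'.image ι), Set.biUnion_image] at hc'
    rw [h.isLUB_iff (hfin.image ι), Set.biUnion_image, h.map_rest, hc, hc']
    exact preimage_image_biUnion_inter fun t t' => by rw [hC.isHom.map_rest, h.map_rest]
  rw [hC.trace_eq hfin hlub, hC.trace_eq hT hc, hC.trace_eq hT' hc']
  exact (preimage_image_biUnion_inter fun t t' => hι.hat_rest hA.isDifferenceRestriction t t').symm

theorem trace_op (s : σ.Symbol) (c : Fin (σ.arity s) → C) :
    trace ι (C.op s c) = opOfRel ((FObj A hA).rel s) fun i => trace ι (c i) := by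
  obtain ⟨P, D, d, γ, h⟩ := exists_pointRep hC.isDRA.isDifferenceRestriction
  have hι := h.comp hC.isHom hC.injective
  choose T hT hc using fun i => hC.exists_finite_isLUB (c i)
  have hfin := (Set.Finite.pi hT).image (A.op s)
  have hlub : IsLUB (ι '' (A.op s '' Set.univ.pi T)) (C.op s c) := by
    rw [h.isLUB_iff (hfin.image ι), h.map_op_eq_biUnion (hC.isDRA.additive s) (hC.isDRA.normal s)
      (fun i => (hT i).image ι) fun i => (h.isLUB_iff ((hT i).image ι) _).1 (hc i)]
    rw [Set.biUnion_image, Set.biUnion_image]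
    ext p
    simp only [Set.mem_iUnion₂, hC.isHom.map_op]
    constructor
    · rintro ⟨b, hb, hp⟩
      choose a ha hab using fun i => hb i trivial
      exact ⟨a, fun i _ => ha i, by rwa [funext hab]⟩
    · rintro ⟨a, ha, hp⟩
      exact ⟨_, fun i _ => ⟨a i, ha i trivial, rfl⟩, hp⟩
  rw [hC.trace_eq hfin hlub, funext fun i => hC.trace_eq (hT i) (hc i), Set.biUnion_image]
  exact (hι.opOfRel_biUnion_hat (hA.additive s) (hA.normal s) T).symm

theorem trace_apply (a : A) : trace ι (ι a) = hat A a := by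
  obtain ⟨P, D, d, γ, h⟩ := exists_pointRep hC.isDRA.isDifferenceRestriction
  rw [hC.trace_eq (T := {a}) (Set.finite_singleton a), Set.biUnion_singleton]
  rw [h.isLUB_iff (Set.toFinite _), Set.image_singleton, Set.biUnion_singleton]

/-- Elements of `A` below a common `c` are compatible, since injectivity of `ι` reflects
compatibility. Their images under `unit` therefore have a join in `G'`, and this join is the trace.
-/
theorem isKO_trace (c : C) : (FObj A hA).IsKO (trace ι c) := by
  obtain ⟨P, D, d, γ, h⟩ := exists_pointRep hC.isDRA.isDifferenceRestriction
  obtain ⟨T, hT, hc⟩ := hC.exists_finite_isLUB c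
  have hcomp : ∀ a ∈ T, ∀ b ∈ T, A.Compatible a b := by
    intro a ha b hb
    refine hC.injective ?_
    rw [hC.isHom.map_rest, hC.isHom.map_rest]
    refine (h.compatible_iff _ _).2 fun p hp q hq e => h.injOn c ?_ ?_ e
    · exact (h.le_iff _ _).1 (hc.1 ⟨a, ha, rfl⟩) hp
    · exact (h.le_iff _ _).1 (hc.1 ⟨b, hb, rfl⟩) hq
  obtain ⟨U, hU⟩ := (isHausEt_fObj hA).complete_gObj (unit hA '' T) (hT.image _) (by
    rintro _ ⟨a, ha, rfl⟩ _ ⟨b, hb, rfl⟩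
    rw [Alg.Compatible, ← (isHom_unit hA).map_rest, ← (isHom_unit hA).map_rest, hcomp a ha b hb])
  rw [(isHausEt_fObj hA).pointRep_gObj.isLUB_iff (hT.image _), Set.biUnion_image] at hU
  rw [hC.trace_eq hT hc]
  exact hU ▸ U.2

theorem isHom_trace : Alg.IsHom C (GObj (FObj A hA) (isHausEt_fObj hA))
    fun c => ⟨trace ι c, hC.isKO_trace hA c⟩ where
  map_diff c c' := Subtype.ext (hC.trace_diff c c')
  map_rest c c' := Subtype.ext (hC.trace_rest hA c c')
  map_op s c := Subtype.ext (hC.trace_op hA s c)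

theorem bijective_trace : Function.Bijective
    (fun c => ⟨trace ι c, hC.isKO_trace hA c⟩ : C → GObj (FObj A hA) (isHausEt_fObj hA)) := by
  obtain ⟨P, D, d, γ, h⟩ := exists_pointRep hC.isDRA.isDifferenceRestriction
  constructor
  · intro c c' e
    have e' : trace ι c = trace ι c' := congrArg Subtype.val e
    exact h.antisymm (hC.le_of_trace_subset e'.subset) (hC.le_of_trace_subset e'.symm.subset)
  · intro U
    obtain ⟨T, hT, hU⟩ := exists_finite_unit hA U
    -- Here compatibility travels the other way: the pieces of `U` lie in one set on which the
    -- projection is injective, so they are compatible in `A` and hence in `C`.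
    obtain ⟨c, hc⟩ := hC.complete (ι '' T) (hT.image ι) (by
      rintro _ ⟨a, ha, rfl⟩ _ ⟨b, hb, rfl⟩
      rw [Alg.Compatible, ← hC.isHom.map_rest, ← hC.isHom.map_rest]
      refine congrArg ι (injective_unit hA ?_)
      rw [(isHom_unit hA).map_rest, (isHom_unit hA).map_rest]
      refine ((isHausEt_fObj hA).pointRep_gObj.compatible_iff _ _).2
        fun μ hμ ν hν e => U.2.2.2 ?_ ?_ e
      · exact hU ▸ Set.mem_biUnion ha hμ
      · exact hU ▸ Set.mem_biUnion hb hν)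
    exact ⟨c, Subtype.ext ((hC.trace_eq hT hc).trans hU.symm)⟩

theorem eq_of_isHom {θ θ' : GObj (FObj A hA) (isHausEt_fObj hA) → C}
    (hθ : Alg.IsHom _ C θ) (bij : Function.Bijective θ) (hθι : ∀ a, θ (unit hA a) = ι a)
    (hθ' : Alg.IsHom _ C θ') (bij' : Function.Bijective θ')
    (hθι' : ∀ a, θ' (unit hA a) = ι a) : θ = θ' := by
  obtain ⟨P, D, d, γ, h⟩ := exists_pointRep hC.isDRA.isDifferenceRestriction
  funext U
  obtain ⟨T, hT, hU⟩ := exists_finite_unit hA U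
  have hlub := isLUB_image_unit hA hT hU
  have h1 := hθ.isLUB_image bij hlub
  have h2 := hθ'.isLUB_image bij' hlub
  simp only [Set.image_image, hθι] at h1
  simp only [Set.image_image, hθι'] at h2
  exact h.antisymm (h1.2 h2.1) (h2.2 h1.1)

theorem existsUnique_isHom : ∃! θ : GObj (FObj A hA) (isHausEt_fObj hA) → C,
    Alg.IsHom (GObj (FObj A hA) (isHausEt_fObj hA)) C θ ∧ Function.Bijective θ ∧
      ∀ a, θ (unit hA a) = ι a := by
  -- The required map is the inverse of the trace, so it need not be shown independent of a choice
  -- of finite joins.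
  let e : C ≃ GObj (FObj A hA) (isHausEt_fObj hA) := Equiv.ofBijective _ (hC.bijective_trace hA)
  have hunit : ∀ a, e.symm (unit hA a) = ι a := by
    intro a
    refine e.symm_apply_eq.2 ?_
    exact Subtype.ext (hC.trace_apply a).symm
  have hhom : Alg.IsHom (GObj (FObj A hA) (isHausEt_fObj hA)) C e.symm :=
    (hC.isHom_trace hA).of_leftInverse e.injective e.apply_symm_apply
  refine ⟨e.symm, ⟨hhom, e.symm.bijective, hunit⟩, ?_⟩
  rintro θ ⟨hθ, bij, hθι⟩
  exact hC.eq_of_isHom hA hθ bij hθι hhom e.symm.bijective hunit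

end Alg.IsFinitaryCompatibleCompletion

end DiffRest

theorem corollary5 {σ : DiffRest.FunSignature.{w}} (A : DiffRest.Alg.{u, w} σ) (hA : A.IsDRA) :
    ∃ (hF : (DiffRest.FObj A hA).IsHausEt)
      (η : A → DiffRest.GObj (DiffRest.FObj A hA) hF),
      (∀ a : A, (η a).1 = DiffRest.hat A a) ∧
      DiffRest.Alg.IsFinitaryCompatibleCompletion A
        (DiffRest.GObj (DiffRest.FObj A hA) hF) η ∧
      (∀ (C : DiffRest.Alg.{v, w} σ) (ι : A → C),
        DiffRest.Alg.IsFinitaryCompatibleCompletion A C ι →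
        ∃! θ : DiffRest.GObj (DiffRest.FObj A hA) hF → C,
          DiffRest.Alg.IsHom (DiffRest.GObj (DiffRest.FObj A hA) hF) C θ ∧
          Function.Bijective θ ∧ ∀ a : A, θ (η a) = ι a) :=
  ⟨DiffRest.isHausEt_fObj hA, DiffRest.unit hA, fun _ => rfl,
    DiffRest.isFinitaryCompatibleCompletion_unit hA, fun _ _ hC => hC.existsUnique_isHom hA⟩
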